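/- An overpartition of a nonnegative integer $m$ is a non-increasing sequence of positive integers (its parts) with sum $m$ in which the first occurrence of each number may be overlined (the empty sequence is the only overpartition of $0$). For $k\ge 1$ and $n\ge 0$, let $\overline{OPT}_k(n)$ denote the number of $k$-tuples $(\pi_1,\dots,\pi_k)$ of overpartitions, all of whose parts are odd, such that the sum of all the parts of $\pi_1,\dots,\pi_k$ equals $n$. Theorem 1.7. Let $i\ge 1$ be an integer, and let $j\ge 1$ be an integer that is not a power of $2$ (where $1=2^0$ counts as a power of $2$), not a multiple of $2$, and not divisible by $3$. Then for all $n\ge 0$, $$\overline{OPT}_{3^i j}(3n+2)\equiv 0 \pmod{2\cdot 3^{i+1}}\qquad\text{and}\qquad \overline{OPT}_{3^i j}(3n+1)\equiv 0 \pmod{2\cdot 3^{i}}.$$ -/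

import Mathlib

open Finset

/-- An overpartition: a partition (a multiset of positive integers, equivalently a non-increasing
sequence of positive integers) in which the first occurrence of each number may be overlined.
The choice of overlines is the set `overlined` of those part sizes whose first occurrence carries
an overline. The empty overpartition is the only overpartition of `0`. -/
@[ext]
structure Overpartition where
  /-- The parts, with multiplicity. -/
  parts : Multiset ℕ
  parts_pos : ∀ a ∈ parts, 0 < a
  /-- The part sizes whose first occurrence is overlined. -/
  overlined : Finset ℕ
  overlined_subset : overlined ⊆ parts.toFinset

namespace Overpartition

/-- The number of which `π` is an overpartition: the sum of its parts. -/
def size (π : Overpartition) : ℕ := π.parts.sum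

/-- All parts of `π` are odd. -/
def HasOddParts (π : Overpartition) : Prop := ∀ a ∈ π.parts, Odd a

end Overpartition

/-- The set of overpartition `k`-tuples of `n` with odd parts: the `k`-tuples `(π₁, …, π_k)` of
overpartitions into odd parts such that all the parts of all the `π_i` sum to `n`. -/
def oddOverpartitionTuples (k n : ℕ) : Set (Fin k → Overpartition) :=
  {π | (∀ i, (π i).HasOddParts) ∧ ∑ i, (π i).size = n}

/-- The number of overpartition `k`-tuples of `n` with odd parts. (The set counted is finite, see
`oddOverpartitionTuples_finite`.) -/
noncomputable def OPT (k n : ℕ) : ℕ := (oddOverpartitionTuples k n).ncard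

theorem Overpartition.finite_size_le (n : ℕ) : {π : Overpartition | π.size ≤ n}.Finite := by
  have hfin : ((Set.Iic (n • Multiset.range (n + 1))) ×ˢ
      (Set.Iic (Finset.range (n + 1)))).Finite :=
    (Set.finite_Iic _).prod (Set.finite_Iic _)
  refine Set.Finite.of_injOn (f := fun π : Overpartition => (π.parts, π.overlined)) ?_ ?_ hfin
  · intro π hπ
    have hπ' : π.parts.sum ≤ n := hπ
    have hle : ∀ a ∈ π.parts, a < n + 1 := fun a ha =>
      Nat.lt_succ_of_le ((Multiset.single_le_sum (fun _ _ => Nat.zero_le _) a ha).trans hπ')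
    refine ⟨?_, ?_⟩
    · simp only [Set.mem_Iic]
      rw [Multiset.le_iff_count]
      intro a
      by_cases ha : a ∈ π.parts
      · have h1 : Multiset.count a (Multiset.range (n + 1)) = 1 :=
          Multiset.count_eq_one_of_mem (Multiset.nodup_range _) (Multiset.mem_range.2 (hle a ha))
        have h2 : π.parts.card • 1 ≤ π.parts.sum :=
          Multiset.card_nsmul_le_sum (fun x hx => π.parts_pos x hx)
        have h3 := Multiset.count_le_card a π.parts
        rw [Multiset.count_nsmul, h1]
        simp only [smul_eq_mul, mul_one] at h2
        omega
      · rw [Multiset.count_eq_zero_of_notMem ha]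
        exact Nat.zero_le _
    · intro a ha
      exact Finset.mem_range.2 (hle a (Multiset.mem_toFinset.1 (π.overlined_subset ha)))
  · intro π _ ρ _ h
    simp only [Prod.mk.injEq] at h
    exact Overpartition.ext h.1 h.2

theorem oddOverpartitionTuples_finite (k n : ℕ) : (oddOverpartitionTuples k n).Finite := by
  refine (Set.Finite.pi (fun _ : Fin k => Overpartition.finite_size_le n)).subset ?_
  rintro π ⟨_, h⟩ i _
  have : (π i).size ≤ ∑ i, (π i).size :=
    Finset.single_le_sum (f := fun i => (π i).size) (fun _ _ => Nat.zero_le _) (Finset.mem_univ i)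
  exact this.trans h.le

/-!
Let `P` be the generating function of overpartitions into odd parts, so that `OPT k n` is the
`n`-th coefficient of `P ^ k` (`natCast_OPT`). From `P = ∏ (1 + X ^ m) / (1 - X ^ m)`, the product
being over odd `m`, its logarithmic derivative is

  `X P' / P = ∑ 2 m X ^ m / (1 - X ^ (2 m)) = ∑ T n X ^ n`,

where `T n` (`oddPairSum`) is the sum of `2 a` over the factorizations `n = a * b` into odd factors.
Comparing coefficients in `X (P ^ k)' = k P ^ k (X P' / P)` gives
`n * OPT k n = k * ∑ OPT k (n - l) * T l` (`coeff_oddOverpartitionSeries_pow_mul`).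

Suppose `3 ^ i ∣ k`. If `3 ∤ n`, the recurrence shows `3 ^ i ∣ OPT k n`. If moreover `i ≥ 1` and
`n ≡ 2` modulo `3`, every summand is divisible by `3`: either `3 ∤ n - l`, and the previous case
applies to `OPT k (n - l)`, or `l ≡ 2` modulo `3`, and then `3 ∣ T l` because `a * b ≡ 2` forces
`a + b ≡ 0` (`three_dvd_oddPairSum`). Hence `3 ^ (i + 1) ∣ OPT k n`. Finally `P ≡ 1` modulo `2`,
which makes `OPT k n` even for `n ≥ 1`.
-/

open PowerSeries
open scoped PowerSeries.WithPiTopology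

/-! ### Logarithmic derivative of the factor of a single part size -/

/-- The generating function of the overpartitions all of whose parts equal `m`: it is
`(1 + X ^ m) / (1 - X ^ m)` for odd `m`, written out coefficientwise. For even `m`, a size that is
not allowed, it is `1`. -/
noncomputable def oddFactor (m : ℕ) : ℤ⟦X⟧ :=
  PowerSeries.mk fun n => if n = 0 then 1 else if Odd m ∧ m ∣ n then 2 else 0

/-- The logarithmic derivative `X G' / G` of the factor `G = oddFactor m`. For odd `m` it is
`2 m X ^ m / (1 - X ^ (2 m))`, which is supported on the odd multiples of `m`; for even `m` it
vanishes. At `n = 0` the coefficient is `0` because `0 / m = 0` is not odd. -/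
noncomputable def oddLogDeriv (m : ℕ) : ℤ⟦X⟧ :=
  PowerSeries.mk fun n => if Odd m ∧ m ∣ n ∧ Odd (n / m) then 2 * (m : ℤ) else 0

theorem one_sub_X_pow_mul_oddFactor {m : ℕ} (hm : Odd m) :
    (1 - X ^ m) * oddFactor m = 1 + X ^ m := by
  have hpos := hm.pos
  ext n
  rw [sub_mul, one_mul, map_sub, coeff_X_pow_mul', map_add, coeff_one, coeff_X_pow]
  simp only [oddFactor, coeff_mk, hm, true_and]
  rcases lt_trichotomy n m with h | rfl | h
  · have : n ≠ 0 → ¬ m ∣ n := fun h0 hd => by have := Nat.le_of_dvd (by omega) hd; omega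
    split_ifs <;> omega
  · simp [hpos.ne']
  · have : m ∣ n - m ↔ m ∣ n := Nat.dvd_sub_self_right.trans (by simp; omega)
    simp only [this, h.le]
    split_ifs <;> omega

theorem one_sub_X_pow_mul_oddLogDeriv {m : ℕ} (hm : Odd m) :
    (1 - X ^ m * X ^ m) * oddLogDeriv m = 2 * (m : ℤ⟦X⟧) * X ^ m := by
  have hpos := hm.pos
  have hC : (2 * (m : ℤ⟦X⟧)) = C (2 * (m : ℤ)) := by simp
  ext n
  rw [hC, ← pow_add, sub_mul, one_mul, map_sub, coeff_X_pow_mul', coeff_C_mul, coeff_X_pow]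
  simp only [oddLogDeriv, coeff_mk, hm, true_and]
  by_cases hd : m ∣ n
  · obtain ⟨c, rfl⟩ := hd
    rcases c with _ | _ | c
    · simp [hpos.ne]
    · simp [hpos.ne', Nat.div_self hpos]
    · have h1 : m * (c + 1 + 1) - (m + m) = m * c := by
        rw [show m * (c + 1 + 1) = m * c + (m + m) by ring]; simp
      have h2 : m + m ≤ m * (c + 1 + 1) := by nlinarith
      have h3 : m * (c + 1 + 1) ≠ m := by nlinarith
      rw [h1]
      simp [h2, h3, hpos, Nat.odd_add_one]
  · have h1 : m + m ≤ n → ¬ m ∣ n - (m + m) := fun h h' =>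
      hd ((Nat.dvd_sub_iff_left h (Dvd.intro_left 2 (by ring))).1 h')
    have h2 : n ≠ m := fun h => hd (by simp [h])
    simp only [hd, h2]
    split_ifs <;> simp_all

theorem coeff_X_mul_derivative (F : ℤ⟦X⟧) (n : ℕ) :
    coeff n (X * d⁄dX ℤ F) = n * coeff n F := by
  cases n with
  | zero => simp
  | succ n => rw [coeff_succ_X_mul, coeff_derivative]; push_cast; ring

theorem X_mul_derivative_oddFactor (m : ℕ) :
    X * d⁄dX ℤ (oddFactor m) = oddFactor m * oddLogDeriv m := by
  by_cases hm : Odd m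
  · have hG := one_sub_X_pow_mul_oddFactor hm
    have hS := one_sub_X_pow_mul_oddLogDeriv hm
    have hX : (X : ℤ⟦X⟧) * X ^ (m - 1) = X ^ m := by rw [← pow_succ', Nat.sub_add_cancel hm.pos]
    have hD := congrArg (d⁄dX ℤ) hG
    simp only [Derivation.leibniz, map_sub, map_add, smul_eq_mul, derivative_pow, derivative_one,
      derivative_X] at hD
    -- Both closed forms are relations with denominators; multiply the claim by
    -- `(1 - X ^ m) ^ 2 * (1 + X ^ m)` to clear them.
    have hne : ((1 : ℤ⟦X⟧) - X ^ m) ^ 2 * (1 + X ^ m) ≠ 0 := by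
      intro h
      have := congrArg (coeff 0) h
      simp [hm.pos.ne'] at this
    apply mul_left_cancel₀ hne
    -- What remains is polynomial algebra in `G`, `G'`, `S` and `Y = X ^ m`, with the relations
    -- `(1 - Y) G = 1 + Y`, its derivative, and `(1 - Y ^ 2) S = 2 m Y`.
    generalize oddFactor m = G at *
    generalize d⁄dX ℤ G = G' at *
    generalize oddLogDeriv m = S at *
    generalize (X : ℤ⟦X⟧) ^ (m - 1) = Z at *
    generalize (X : ℤ⟦X⟧) ^ m = Y at *
    have hD' : (1 - Y) * (X * G') = (m : ℤ⟦X⟧) * Y * (1 + G) := by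
      linear_combination X * hD + (m : ℤ⟦X⟧) * (1 + G) * hX
    linear_combination (1 - Y) * (1 + Y) * hD' - (1 - Y) * G * hS
      + ((m : ℤ⟦X⟧) * Y * (1 + Y) - 2 * m * Y) * hG
  · have h1 : oddFactor m = 1 := by ext n; simp [oddFactor, hm, coeff_one]
    have h2 : oddLogDeriv m = 0 := by ext n; simp [oddLogDeriv, hm]
    simp [h1, h2]

theorem X_mul_derivative_prod_oddFactor {ι : Type*} (s : Finset ι) (g : ι → ℕ) :
    X * d⁄dX ℤ (∏ i ∈ s, oddFactor (g i)) =
      (∏ i ∈ s, oddFactor (g i)) * ∑ i ∈ s, oddLogDeriv (g i) := by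
  classical
  induction s using Finset.induction_on with
  | empty => simp
  | insert a s ha ih =>
    rw [prod_insert ha, sum_insert ha, Derivation.leibniz, smul_eq_mul, smul_eq_mul]
    linear_combination oddFactor (g a) * ih +
      (∏ i ∈ s, oddFactor (g i)) * X_mul_derivative_oddFactor (g a)

/-! ### The generating function and its recurrence -/

/-- The generating function of overpartitions into odd parts: a partition into odd parts carries
the weight `2` for each distinct part size, since that size may or may not be overlined. -/
noncomputable def oddOverpartitionSeries : ℤ⟦X⟧ :=
  Nat.Partition.genFun fun i _ => if Odd i then 2 else 0

theorem hasProd_oddFactor :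
    HasProd (fun i => oddFactor (i + 1)) oddOverpartitionSeries := by
  have h := Nat.Partition.hasProd_genFun (R := ℤ) (fun i _ => if Odd i then 2 else 0)
  refine (congrArg (HasProd · oddOverpartitionSeries) (funext fun i => ?_)).mpr h
  rw [← sub_eq_iff_eq_add']
  refine (HasSum.tsum_eq ?_).symm
  rw [WithPiTopology.hasSum_iff_hasSum_coeff]
  intro n
  simp only [oddFactor, map_sub, coeff_mk, map_smul, coeff_X_pow, coeff_one, smul_eq_mul]
  by_cases h : ∃ c, n = (i + 1) * (c + 1)
  · obtain ⟨c, rfl⟩ := h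
    convert hasSum_single c ?_ using 1
    · simp
    · intro c' hc
      simp [hc.symm]
  · convert hasSum_zero using 1
    · ext c
      rw [if_neg (fun h' => h ⟨c, h'⟩), mul_zero]
    · by_cases hn : n = 0
      · simp [hn]
      · have : ¬ (i + 1) ∣ n := by
          rintro ⟨c, rfl⟩
          rcases c with _ | c
          · simp at hn
          · exact h ⟨c, rfl⟩
        simp [hn, this]

/-- The sum of `2 a` over the factorizations `n = a * b` into two odd factors. It is the `n`-th
coefficient of the logarithmic derivative of `oddOverpartitionSeries`. -/
def oddPairSum (n : ℕ) : ℤ :=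
  ∑ p ∈ n.divisorsAntidiagonal, if Odd p.1 ∧ Odd p.2 then 2 * (p.1 : ℤ) else 0

theorem coeff_sum_oddLogDeriv {s : Finset ℕ} {n : ℕ} (hs : range n ⊆ s) :
    coeff n (∑ i ∈ s, oddLogDeriv (i + 1)) = oddPairSum n := by
  rw [map_sum, oddPairSum, Nat.sum_divisorsAntidiagonal
    (f := fun a b => if Odd a ∧ Odd b then 2 * (a : ℤ) else 0)]
  simp only [oddLogDeriv, coeff_mk]
  symm
  refine sum_of_injOn (fun a => a - 1) ?_ ?_ ?_ ?_
  · intro a ha b hb hab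
    have := Nat.pos_of_mem_divisors (Finset.mem_coe.1 ha)
    have := Nat.pos_of_mem_divisors (Finset.mem_coe.1 hb)
    simp only at hab
    omega
  · intro a ha
    have h1 := Nat.pos_of_mem_divisors (Finset.mem_coe.1 ha)
    have h2 := Nat.divisor_le (Finset.mem_coe.1 ha)
    exact hs (Finset.mem_range.2 (show a - 1 < n by omega))
  · intro a _ ha
    rw [if_neg]
    rintro ⟨-, h1, h2⟩
    refine ha ⟨a + 1, ?_, rfl⟩
    rw [Finset.mem_coe, Nat.mem_divisors]
    refine ⟨h1, ?_⟩
    rintro rfl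
    simp at h2
  · intro a ha
    have h1 := Nat.pos_of_mem_divisors ha
    rw [Nat.sub_add_cancel h1]
    simp [Nat.dvd_of_mem_divisors ha]

theorem X_mul_derivative_oddOverpartitionSeries :
    X * d⁄dX ℤ oddOverpartitionSeries = oddOverpartitionSeries * PowerSeries.mk oddPairSum := by
  ext n
  -- The identity holds for finite partial products; take one that agrees with the infinite product
  -- up to degree `n` and contains all factors of index at most `n`.
  have hev : ∀ᶠ s in Filter.atTop, ∀ l ∈ range (n + 1),
      coeff l (∏ i ∈ s, oddFactor (i + 1)) = coeff l oddOverpartitionSeries := by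
    rw [Filter.eventually_all_finset]
    intro l _
    have := (WithPiTopology.tendsto_iff_coeff_tendsto (R := ℤ) _ _ _).1 hasProd_oddFactor l
    rw [nhds_discrete, Filter.tendsto_pure] at this
    exact this
  obtain ⟨s, hs, hr⟩ := (hev.and (Filter.eventually_ge_atTop (range n))).exists
  have key := congrArg (coeff n) (X_mul_derivative_prod_oddFactor s (· + 1))
  rw [coeff_X_mul_derivative] at key ⊢
  rw [← hs n (by simp), key, coeff_mul, coeff_mul]
  refine sum_congr rfl fun p hp => ?_
  have h := mem_antidiagonal.1 hp
  rw [hs p.1 (by simp; omega), coeff_mk, coeff_sum_oddLogDeriv]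
  exact (range_subset_range.2 (by omega)).trans hr

/-- The recurrence obtained by comparing coefficients in `X (P ^ k)' = k P ^ k (X P' / P)`. -/
theorem coeff_oddOverpartitionSeries_pow_mul (k n : ℕ) :
    (n : ℤ) * coeff n (oddOverpartitionSeries ^ k) =
      k * ∑ p ∈ antidiagonal n, coeff p.1 (oddOverpartitionSeries ^ k) * oddPairSum p.2 := by
  have h : X * d⁄dX ℤ (oddOverpartitionSeries ^ k) =
      (k : ℤ⟦X⟧) * (oddOverpartitionSeries ^ k * PowerSeries.mk oddPairSum) := by
    rcases k with _ | k
    · simp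
    · rw [derivative_pow, Nat.add_sub_cancel, pow_succ]
      linear_combination (((k + 1 : ℕ) : ℤ⟦X⟧) * oddOverpartitionSeries ^ k) *
        X_mul_derivative_oddOverpartitionSeries
  have h' := congrArg (coeff n) h
  have hC : (k : ℤ⟦X⟧) = C (k : ℤ) := by simp
  rw [hC, coeff_C_mul, coeff_mul n (oddOverpartitionSeries ^ k), coeff_X_mul_derivative] at h'
  simpa only [coeff_mk] using h'

/-! ### Divisibility of the coefficients -/

/-- If `a * b ≡ 2 [MOD 3]`, then `a + b ≡ 0 [MOD 3]`, so the terms of the factorizations `(a, b)`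
and `(b, a)` cancel modulo `3`. -/
theorem three_dvd_oddPairSum {l : ℕ} (hl : l % 3 = 2) : 3 ∣ oddPairSum l := by
  have hswap : oddPairSum l =
      ∑ p ∈ l.divisorsAntidiagonal, if Odd p.1 ∧ Odd p.2 then 2 * (p.2 : ℤ) else 0 := by
    rw [oddPairSum]
    refine sum_nbij' Prod.swap Prod.swap ?_ ?_ ?_ ?_ ?_ <;>
      simp [Nat.swap_mem_divisorsAntidiagonal, and_comm, mul_comm]
  have h2 : (3 : ℤ) ∣ oddPairSum l + oddPairSum l := by
    nth_rw 2 [hswap]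
    rw [oddPairSum, ← sum_add_distrib]
    refine dvd_sum fun p hp => ?_
    have hp' := (Nat.mem_divisorsAntidiagonal.1 hp).1
    split_ifs
    · have : (p.1 + p.2) % 3 = 0 := by
        rw [← hp', Nat.mul_mod] at hl
        have h1 := Nat.mod_lt p.1 (show 3 > 0 by norm_num)
        have h2 := Nat.mod_lt p.2 (show 3 > 0 by norm_num)
        rw [Nat.add_mod]
        interval_cases p.1 % 3 <;> interval_cases p.2 % 3 <;> omega
      omega
    · simp
  omega

/-- Every nonempty partition has weight divisible by `2`, so the series is `1` modulo `2`. -/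
theorem two_dvd_coeff_oddOverpartitionSeries_pow (k : ℕ) {n : ℕ} (hn : n ≠ 0) :
    2 ∣ coeff n (oddOverpartitionSeries ^ k) := by
  have h1 : PowerSeries.map (Int.castRingHom (ZMod 2)) oddOverpartitionSeries = 1 := by
    ext m
    rw [coeff_map, oddOverpartitionSeries, Nat.Partition.coeff_genFun, map_sum, coeff_one]
    rcases eq_or_ne m 0 with rfl | hm
    · rw [Fintype.sum_unique]
      simp
    · rw [if_neg hm]
      refine sum_eq_zero fun p _ => ?_
      have hp : p.parts ≠ 0 := fun h => hm (by rw [← p.parts_sum, h, Multiset.sum_zero])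
      obtain ⟨a, ha⟩ := Multiset.exists_mem_of_ne_zero hp
      rw [Finsupp.prod, map_prod]
      refine prod_eq_zero (i := a) (by simpa using ha) ?_
      split_ifs
      · exact (by decide : ((2 : ℤ) : ZMod 2) = 0)
      · simp
  have h2 := congrArg (coeff n) (congrArg (· ^ k) h1)
  simp only [one_pow, ← map_pow, coeff_map, coeff_one, hn] at h2
  exact (ZMod.intCast_zmod_eq_zero_iff_dvd _ 2).1 (by simpa using h2)

theorem dvd_coeff_oddOverpartitionSeries_pow {i k n : ℕ} (hk : 3 ^ i ∣ k) (hn : n % 3 ≠ 0) :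
    (3 ^ i : ℤ) ∣ coeff n (oddOverpartitionSeries ^ k) := by
  have hco : IsCoprime (3 ^ i : ℤ) (n : ℤ) := by
    apply IsCoprime.pow_left
    exact_mod_cast Nat.isCoprime_iff_coprime.2
      ((Nat.Prime.coprime_iff_not_dvd Nat.prime_three).2 (by omega))
  apply hco.dvd_of_dvd_mul_left
  rw [coeff_oddOverpartitionSeries_pow_mul]
  exact Dvd.dvd.mul_right (by exact_mod_cast hk) _

theorem dvd_coeff_oddOverpartitionSeries_pow_succ {i k n : ℕ} (hi : 1 ≤ i) (hk : 3 ^ i ∣ k)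
    (hn : n % 3 = 2) : (3 ^ (i + 1) : ℤ) ∣ coeff n (oddOverpartitionSeries ^ k) := by
  have hco : IsCoprime (3 ^ (i + 1) : ℤ) (n : ℤ) := by
    apply IsCoprime.pow_left
    exact_mod_cast Nat.isCoprime_iff_coprime.2
      ((Nat.Prime.coprime_iff_not_dvd Nat.prime_three).2 (by omega))
  apply hco.dvd_of_dvd_mul_left
  rw [coeff_oddOverpartitionSeries_pow_mul, pow_succ]
  refine mul_dvd_mul (by exact_mod_cast hk) (dvd_sum fun p hp => ?_)
  have hp' := mem_antidiagonal.1 hp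
  -- If `3 ∣ p.1` then `p.2 ≡ 2 [MOD 3]`; otherwise the weaker divisibility applies at `p.1`.
  by_cases h : p.1 % 3 = 0
  · exact (three_dvd_oddPairSum (by omega)).mul_left _
  · have h3 : 3 ^ 1 ∣ k := (pow_dvd_pow 3 hi).trans hk
    exact (by simpa using dvd_coeff_oddOverpartitionSeries_pow h3 h :
      (3 : ℤ) ∣ coeff p.1 (oddOverpartitionSeries ^ k)).mul_right _

/-! ### Counting tuples of overpartitions -/

theorem Overpartition.finite_odd_size_eq (n : ℕ) :
    {π : Overpartition | π.HasOddParts ∧ π.size = n}.Finite :=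
  (Overpartition.finite_size_le n).subset fun _ h => h.2.le

/-- The weight of a partition into odd parts counts the possible sets of overlined sizes, which are
the subsets of the set of part sizes. -/
theorem coeff_oddOverpartitionSeries (n : ℕ) :
    coeff n oddOverpartitionSeries = (Overpartition.finite_odd_size_eq n).toFinset.card := by
  classical
  have hprod : ∀ p : n.Partition, p.parts.toFinsupp.prod (fun i _ => if Odd i then (2 : ℤ) else 0) =
      if ∀ a ∈ p.parts, Odd a then ((p.parts.toFinset.powerset.card : ℕ) : ℤ) else 0 := by
    intro p
    rw [Finsupp.prod, Multiset.toFinsupp_support]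
    split_ifs with h
    · rw [prod_congr rfl (g := fun _ => (2 : ℤ)) fun i hi => if_pos (h i (by simpa using hi))]
      simp [card_powerset]
    · push Not at h
      obtain ⟨a, ha, ha'⟩ := h
      exact prod_eq_zero (i := a) (by simpa using ha) (if_neg (by simpa using ha'))
  rw [oddOverpartitionSeries, Nat.Partition.coeff_genFun, sum_congr rfl fun p _ => hprod p,
    ← sum_filter, ← Nat.cast_sum, ← card_sigma]
  refine congrArg Nat.cast (card_bij
    (fun x hx => ⟨x.1.parts, fun a ha => x.1.parts_pos ha, x.2, by
      simpa using (mem_sigma.1 hx).2⟩) ?_ ?_ ?_)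
  · intro x hx
    have h := (mem_filter.1 (mem_sigma.1 hx).1).2
    rw [Set.Finite.mem_toFinset]
    exact ⟨h, x.1.parts_sum⟩
  · rintro ⟨p, o⟩ _ ⟨p', o'⟩ _ h
    simp only [Overpartition.mk.injEq] at h
    obtain rfl : p = p' := Nat.Partition.ext h.1
    rw [h.2]
  · intro π hπ
    rw [Set.Finite.mem_toFinset] at hπ
    refine ⟨⟨⟨π.parts, fun {a} ha => π.parts_pos a ha, hπ.2⟩, π.overlined⟩, ?_, rfl⟩
    simp only [mem_sigma, mem_filter, mem_univ, true_and, mem_powerset]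
    exact ⟨hπ.1, π.overlined_subset⟩

/-- The number of `k`-tuples has generating function the `k`-th power of that of a single
overpartition: classify the tuples by the sizes of their components. -/
theorem natCast_OPT (k n : ℕ) : (OPT k n : ℤ) = coeff n (oddOverpartitionSeries ^ k) := by
  classical
  have hpow : oddOverpartitionSeries ^ k = ∏ _i : Fin k, oddOverpartitionSeries := by simp
  rw [hpow, coeff_prod, OPT, Set.ncard_eq_toFinset_card _ (oddOverpartitionTuples_finite k n)]
  simp_rw [coeff_oddOverpartitionSeries, ← Nat.cast_prod, ← Fintype.card_piFinset]
  rw [← Nat.cast_sum]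
  rw [card_eq_sum_card_fiberwise (t := finsuppAntidiag univ n)
    (f := fun π => Finsupp.equivFunOnFinite.symm fun i => (π i).size)]
  · refine congrArg Nat.cast (sum_congr rfl fun l hl => congrArg card ?_)
    have hl' := (mem_finsuppAntidiag.1 hl).1
    ext π
    simp only [mem_filter, Set.Finite.mem_toFinset, Fintype.mem_piFinset, Set.mem_ofPred_eq,
      oddOverpartitionTuples, Finsupp.ext_iff, Finsupp.equivFunOnFinite_symm_apply_apply]
    constructor
    · exact fun h i => ⟨h.1.1 i, h.2 i⟩
    · refine fun h => ⟨⟨fun i => (h i).1, ?_⟩, fun i => (h i).2⟩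
      rw [← hl']
      exact sum_congr rfl fun i _ => (h i).2
  · intro π hπ
    have hπ' : π ∈ oddOverpartitionTuples k n := by simpa using hπ
    simpa [mem_finsuppAntidiag] using hπ'.2

theorem theorem1p7 (i j : ℕ) (hi : 1 ≤ i) (hj_odd : ¬ 2 ∣ j) (hj_three : ¬ 3 ∣ j)
    (hj_pow : ¬ ∃ m : ℕ, j = 2 ^ m) (n : ℕ) :
    OPT (3 ^ i * j) (3 * n + 2) ≡ 0 [MOD 2 * 3 ^ (i + 1)] ∧
      OPT (3 ^ i * j) (3 * n + 1) ≡ 0 [MOD 2 * 3 ^ i] := by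
  have combine : ∀ {m e : ℕ}, m ≠ 0 →
      ((3 ^ e : ℕ) : ℤ) ∣ coeff m (oddOverpartitionSeries ^ (3 ^ i * j)) →
      OPT (3 ^ i * j) m ≡ 0 [MOD 2 * 3 ^ e] := by
    intro m e hm h3
    rw [Nat.modEq_zero_iff_dvd]
    rw [← natCast_OPT, Int.natCast_dvd_natCast] at h3
    have h2 := two_dvd_coeff_oddOverpartitionSeries_pow (3 ^ i * j) hm
    rw [← natCast_OPT] at h2
    exact (Nat.Coprime.pow_right e (by norm_num)).mul_dvd_of_dvd_of_dvd (by exact_mod_cast h2) h3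
  have hk : 3 ^ i ∣ 3 ^ i * j := dvd_mul_right _ _
  constructor
  · exact combine (by omega) (by
      exact_mod_cast dvd_coeff_oddOverpartitionSeries_pow_succ hi hk (by omega))
  · exact combine (by omega) (by
      exact_mod_cast dvd_coeff_oddOverpartitionSeries_pow hk (by omega))
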